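/- Let $H$ be a class of measurable $\{0,1\}$-valued hypotheses of finite VC-dimension $d$ on an instance space $X$, and let $h^*\in H$ be the target. There are $k\ge 3$ players; player $i$ has an unknown distribution $D_i$ on $X$ and a known noise rate $0\le\eta_i<1/2$, and his example oracle returns $(x,y)$ with $x\sim D_i$, where $y=h^*(x)$ with probability $1-\eta_i$ and $y=\neg h^*(x)$ with probability $\eta_i$. Put $\eta_{\max}=\max_i\eta_i$, $\bar\eta_N=\frac1{|N|}\sum_{i\in N}\eta_i$, and let $\log$ be the logarithm to base $2$. Let $0<\epsilon<1$, $0<\delta<1$ and $\delta'=\delta/(2\log k)$. Personalized Learning with Classification Noise is the following algorithm. Start with $N_1=\{1,\dots,k\}$. In each round $j=1,\dots,\lceil\log k\rceil$ (as long as $N_j\neq\emptyset$): draw from the uniform mixture of the noisy oracles of the players in $N_j$ a sample of size $$m_{\epsilon/4,\delta',\bar\eta_{N_j}},\qquad m_{\epsilon,\delta,\eta}=\left\lceil c_1\frac{d\ln(1/\delta)}{\epsilon(1-2\eta)^2}\right\rceil ,$$ and select $h_j\in H$ minimizing the number of disagreements with it (ERM); then each player $i\in N_j$ draws $\left\lceil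 c_2\frac{\ln(|N_j|/\delta')}{\epsilon(1-2\eta_i)}\right\rceil$ fresh noisy examples; every player $i\in N_j$ on whose examples $h_j$ has empirical error at most $\eta_i+\frac{3\epsilon}{4}(1-2\eta_i)$ is assigned $f_i=h_j$ and removed, which gives $N_{j+1}$. Here $c_1,c_2>0$ are the fixed constants hidden in the $O$'s of the sample sizes. The sample complexity of the algorithm is the total number of examples that it consumes over all rounds and players. For fixed $c_1,c_2,\delta$, with probability one over the draws and for every choice of ERM, the sample complexity of the algorithm is $$O\left(\log k\left(\frac{k\ln(k\log k)}{\epsilon(1-2\eta_{\max})}+\frac{d\ln(\log k)}{\epsilon(1-2\eta_{\max})^2}\right)\right),$$ where the hidden constant depends only on $c_1,c_2,\delta$. If moreover $k\ln k\le A\,d$ for a constant $A$, it is $$\tilde O\left(\log k\cdot\frac{d}{\epsilon(1-2\eta_{\max})^2}\right),$$ that is, with $F=\log k\cdot\frac{d}{\epsilon(1-2\eta_{\max})^2}$ it is at most $C\,F\,(\ln F)^p$, where $C$ and $p$ depend only on $c_1,c_2,\delta,A$. -/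

import Mathlib

open MeasureTheory
open scoped ENNReal

universe u

namespace CollabCN

/-- A hypothesis class is a set of `{0,1}`-valued functions; `s` is shattered by `H` if every
labelling of `s` is realised on `s` by a member of `H`. -/
def Shatters {X : Type u} (H : Set (X → Bool)) (s : Finset X) : Prop :=
  ∀ g : X → Bool, ∃ h ∈ H, ∀ x ∈ s, h x = g x

/-- `H` has (finite) VC-dimension exactly `d`. -/
def HasVCDim {X : Type u} (H : Set (X → Bool)) (d : ℕ) : Prop :=
  (∃ s : Finset X, s.card = d ∧ Shatters H s) ∧ ∀ s : Finset X, Shatters H s → s.card ≤ d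

/-- An instance of collaborative learning with classification noise: `k` players, player `i` having
a distribution `D i` on the instance space and a noise rate `η i < 1/2`; the target hypothesis is
common to all players and belongs to the hypothesis class. -/
structure Problem (X : Type u) [MeasurableSpace X] (k : ℕ) where
  /-- the hypothesis class -/
  H : Set (X → Bool)
  measurable_of_mem : ∀ h ∈ H, Measurable h
  /-- the target hypothesis -/
  target : X → Bool
  target_mem : target ∈ H
  /-- the players' clean distributions -/
  D : Fin k → Measure X
  isProbabilityMeasure_D : ∀ i, IsProbabilityMeasure (D i)
  /-- the players' noise rates -/
  η : Fin k → ℝ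
  η_nonneg : ∀ i, 0 ≤ η i
  η_lt_half : ∀ i, η i < 1 / 2

/-- Number of disagreements of a hypothesis with a labelled sample. -/
def disagreements {X : Type u} (h : X → Bool) (S : List (X × Bool)) : ℕ :=
  S.countP (fun z => h z.1 != z.2)

/-- Empirical error of a hypothesis on a labelled sample. -/
noncomputable def empErr {X : Type u} (h : X → Bool) (S : List (X × Bool)) : ℝ :=
  (disagreements h S : ℝ) / S.length

/-- `erm` selects from every sample a hypothesis of `H` that minimises the number of disagreements
with the sample. -/
def IsERM {X : Type u} (H : Set (X → Bool)) (erm : List (X × Bool) → X → Bool) : Prop :=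
  ∀ S, erm S ∈ H ∧ ∀ h ∈ H, disagreements (erm S) S ≤ disagreements h S

/-- The size `m_{ε,δ,η}` of the sample on which empirical risk minimisation is run for a class of
VC-dimension `d` under noise rate `η`: `c * d * log (1/δ) / (ε * (1 - 2η)²)`, rounded up. -/
noncomputable def ermSize (c : ℝ) (d : ℕ) (ε δ η : ℝ) : ℕ :=
  ⌈c * (d * Real.log (1 / δ) / (ε * (1 - 2 * η) ^ 2))⌉₊

/-- The number of examples that a player with noise rate `η` draws in a test of `n` players:
`c * ln (n/δ) / (ε * (1 - 2η))`, rounded up. -/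
noncomputable def testSize (c : ℝ) (n : ℕ) (ε δ η : ℝ) : ℕ :=
  ⌈c * (Real.log (n / δ) / (ε * (1 - 2 * η)))⌉₊

/-- The state of the learner: the players that have not received a hypothesis yet, the hypotheses
handed out so far, and all the labelled examples that have been drawn so far. -/
structure State (X : Type u) (k : ℕ) where
  active : Finset (Fin k)
  output : Fin k → Option (X → Bool)
  drawn : List (X × Bool)

/-- The addresses of the random examples. `inl (j, N, n)` is the `n`-th draw of round `j` from the
uniform mixture of the players in `N`; `inr (j, i, n)` is the `n`-th draw of player `i` for the test
of round `j`. -/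
abbrev Address (k : ℕ) : Type :=
  (ℕ × {N : Finset (Fin k) // N.Nonempty} × ℕ) ⊕ (ℕ × Fin k × ℕ)

namespace Problem

variable {X : Type u} [MeasurableSpace X] {k : ℕ}

/-- The noisy example oracle of player `i`: `x` is drawn from `D i`, and its label is the correct
one with probability `1 - η i` and the wrong one with probability `η i`. -/
noncomputable def noisy (P : Problem X k) (i : Fin k) : Measure (X × Bool) :=
  ENNReal.ofReal (1 - P.η i) • (P.D i).map (fun x => (x, P.target x)) +
    ENNReal.ofReal (P.η i) • (P.D i).map (fun x => (x, !P.target x))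

/-- The uniform mixture of the noisy example oracles of the players in `N`. -/
noncomputable def mixture (P : Problem X k) (N : Finset (Fin k)) : Measure (X × Bool) :=
  (N.card : ℝ≥0∞)⁻¹ • ∑ i ∈ N, P.noisy i

instance isProbabilityMeasure_noisy (P : Problem X k) (i : Fin k) :
    IsProbabilityMeasure (P.noisy i) := by
  have hD := P.isProbabilityMeasure_D i
  have hm : Measurable P.target := P.measurable_of_mem _ P.target_mem
  have hn : Measurable (fun x => !P.target x) := (measurable_of_finite Bool.not).comp hm
  constructor
  have h1 : 0 ≤ 1 - P.η i := by linarith [P.η_lt_half i]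
  have e1 : (P.D i).map (fun x => (x, P.target x)) Set.univ = 1 := by
    rw [Measure.map_apply (measurable_id'.prodMk hm) MeasurableSet.univ]; simp
  have e2 : (P.D i).map (fun x => (x, !P.target x)) Set.univ = 1 := by
    rw [Measure.map_apply (measurable_id'.prodMk hn) MeasurableSet.univ]; simp
  rw [noisy, Measure.add_apply, Measure.smul_apply, Measure.smul_apply, e1, e2]
  simp [← ENNReal.ofReal_add h1 (P.η_nonneg i)]

lemma isProbabilityMeasure_mixture (P : Problem X k) {N : Finset (Fin k)} (hN : N.Nonempty) :
    IsProbabilityMeasure (P.mixture N) := by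
  constructor
  have hc : (N.card : ℝ≥0∞) ≠ 0 := by exact_mod_cast hN.card_pos.ne'
  simp [mixture, Measure.smul_apply, Measure.finsetSum_apply, measure_univ,
    ENNReal.inv_mul_cancel hc (ENNReal.natCast_ne_top _)]

/-- The distribution of the example found at an address. -/
noncomputable def sourceAt (P : Problem X k) : Address k → Measure (X × Bool)
  | .inl a => P.mixture a.2.1.1
  | .inr a => P.noisy a.2.1

instance isProbabilityMeasure_sourceAt (P : Problem X k) (a : Address k) :
    IsProbabilityMeasure (P.sourceAt a) := by
  cases a with
  | inl a => exact P.isProbabilityMeasure_mixture a.2.1.2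
  | inr a => exact P.isProbabilityMeasure_noisy a.2.1

/-- The law of the random examples: all draws are independent. -/
noncomputable def law (P : Problem X k) : Measure (Address k → X × Bool) :=
  Measure.infinitePi P.sourceAt

instance isProbabilityMeasure_law (P : Problem X k) : IsProbabilityMeasure P.law := by
  unfold law; infer_instance

/-- The average noise rate of the players in `N`. -/
noncomputable def avgNoise (P : Problem X k) (N : Finset (Fin k)) : ℝ :=
  (∑ i ∈ N, P.η i) / N.card

/-- The largest noise rate. -/
noncomputable def maxNoise (P : Problem X k) : ℝ := ⨆ i, P.η i

open Classical in
/-- Round `j` of Personalized Learning with Classification Noise, with accuracy `ε` and per-round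
confidence `δ'`. With `N` the set of active players: a sample of size `m_{ε/4,δ',η̄_N}` is drawn
from the mixture of the players in `N`, an empirical risk minimiser `h` on it is selected, every
player in `N` draws a fresh test sample, the players whose empirical error for `h` is at most
`η i + (3ε/4)(1 - 2 η i)` receive `h` and are removed. Nothing happens if no player is active. -/
noncomputable def round (P : Problem X k) (c₁ c₂ : ℝ) (d : ℕ) (ε δ' : ℝ)
    (erm : List (X × Bool) → X → Bool) (ω : Address k → X × Bool) (j : ℕ) (s : State X k) :
    State X k :=
  if hN : s.active.Nonempty then
    let N := s.active
    let S := (List.range (ermSize c₁ d (ε / 4) δ' (P.avgNoise N))).map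
      (fun n => ω (.inl (j, ⟨N, hN⟩, n)))
    let h := erm S
    let T : Fin k → List (X × Bool) := fun i =>
      (List.range (testSize c₂ N.card ε δ' (P.η i))).map (fun n => ω (.inr (j, i, n)))
    let G := N.filter (fun i => empErr h (T i) ≤ P.η i + 3 * ε / 4 * (1 - 2 * P.η i))
    { active := N \ G
      output := fun i => if i ∈ G then some h else s.output i
      drawn := s.drawn ++ S ++ N.toList.flatMap T }
  else s

/-- The state after the first `j` rounds; at the start every player is active. -/
noncomputable def stateAfter (P : Problem X k) (c₁ c₂ : ℝ) (d : ℕ) (ε δ' : ℝ)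
    (erm : List (X × Bool) → X → Bool) (ω : Address k → X × Bool) : ℕ → State X k
  | 0 => { active := Finset.univ, output := fun _ => none, drawn := [] }
  | j + 1 => P.round c₁ c₂ d ε δ' erm ω j (P.stateAfter c₁ c₂ d ε δ' erm ω j)

/-- Personalized Learning with Classification Noise: `⌈log k⌉` rounds with `δ' = δ / (2 log k)`. -/
noncomputable def run (P : Problem X k) (c₁ c₂ : ℝ) (d : ℕ) (ε δ : ℝ)
    (erm : List (X × Bool) → X → Bool) (ω : Address k → X × Bool) : State X k :=
  P.stateAfter c₁ c₂ d ε (δ / (2 * Real.logb 2 k)) erm ω ⌈Real.logb 2 k⌉₊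

/-- The total number of examples that the algorithm consumes, over all rounds and players. -/
noncomputable def samplesUsed (P : Problem X k) (c₁ c₂ : ℝ) (d : ℕ) (ε δ : ℝ)
    (erm : List (X × Bool) → X → Bool) (ω : Address k → X × Bool) : ℕ :=
  (P.run c₁ c₂ d ε δ erm ω).drawn.length

end Problem

end CollabCN

namespace CollabCN

namespace Problem

variable {X : Type u} [MeasurableSpace X] {k : ℕ}

/-! The bound is deterministic: sample sizes depend on the draws only through the active set, so it
suffices to bound the cost of one round uniformly over nonempty active sets `N` and multiply by the
number of rounds (`length_drawn_stateAfter_le`). Each `1 - 2η` that occurs, also for the average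
noise of `N`, is at least `m = 1 - 2η_max`, and `N` has at most `k` members. With `L = log k` and `D
= ln (2/δ)`, the confidence `δ/(2L)` turns the logarithms into `D + ln L` and `D + ln (kL)`. As `k ≥
3`, `ln L ≥ 1/3`, so `D` is absorbed into a constant factor (`samplesUsed_le`). If `k ln k ≤ A d`,
then `ln (kL) ≤ 2 ln k` makes the test term `O(d)`, and the remaining `ln L` is at most `ln F`. -/

lemma η_le_maxNoise (P : Problem X k) (i : Fin k) : P.η i ≤ P.maxNoise :=
  le_ciSup (Set.finite_range P.η).bddAbove i

lemma maxNoise_lt_half (P : Problem X k) (hk : 0 < k) : P.maxNoise < 1 / 2 := by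
  have : Nonempty (Fin k) := ⟨⟨0, hk⟩⟩
  obtain ⟨i, hi⟩ := exists_eq_ciSup_of_finite (f := P.η)
  rw [maxNoise, ← hi]
  exact P.η_lt_half i

lemma maxNoise_nonneg (P : Problem X k) : 0 ≤ P.maxNoise :=
  Real.iSup_nonneg P.η_nonneg

lemma avgNoise_le_maxNoise (P : Problem X k) {N : Finset (Fin k)} (hN : N.Nonempty) :
    P.avgNoise N ≤ P.maxNoise := by
  have hc : (0 : ℝ) < N.card := by exact_mod_cast hN.card_pos
  rw [avgNoise, div_le_iff₀ hc, mul_comm, ← nsmul_eq_mul]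
  exact Finset.sum_le_card_nsmul _ _ _ fun i _ => P.η_le_maxNoise i

/-- The examples consumed in a round with a nonempty set of active players. -/
lemma length_drawn_round (P : Problem X k) (c₁ c₂ : ℝ) (d : ℕ) (ε δ' : ℝ)
    (erm : List (X × Bool) → X → Bool) (ω : Address k → X × Bool) (j : ℕ) (s : State X k)
    (hN : s.active.Nonempty) :
    (P.round c₁ c₂ d ε δ' erm ω j s).drawn.length = s.drawn.length +
      ermSize c₁ d (ε / 4) δ' (P.avgNoise s.active) +
      ∑ i ∈ s.active, testSize c₂ s.active.card ε δ' (P.η i) := by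
  rw [round, dif_pos hN]
  simp [List.length_flatMap, add_assoc]

/-- If no nonempty set of active players consumes more than `B` examples in a round, then `j`
rounds consume at most `j * B` examples. -/
lemma length_drawn_stateAfter_le (P : Problem X k) (c₁ c₂ : ℝ) (d : ℕ) (ε δ' : ℝ)
    (erm : List (X × Bool) → X → Bool) (ω : Address k → X × Bool) {B : ℝ} (hB0 : 0 ≤ B)
    (hB : ∀ N : Finset (Fin k), N.Nonempty →
      (ermSize c₁ d (ε / 4) δ' (P.avgNoise N) : ℝ) +
        ∑ i ∈ N, (testSize c₂ N.card ε δ' (P.η i) : ℝ) ≤ B) (j : ℕ) :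
    ((P.stateAfter c₁ c₂ d ε δ' erm ω j).drawn.length : ℝ) ≤ j * B := by
  induction j with
  | zero => simp [stateAfter]
  | succ j ih =>
    rw [stateAfter]
    by_cases hN : (P.stateAfter c₁ c₂ d ε δ' erm ω j).active.Nonempty
    · rw [length_drawn_round _ _ _ _ _ _ _ _ _ _ hN]
      have := hB _ hN
      push_cast
      linarith
    -- A round without active players draws nothing; `0 ≤ B` covers it.
    · rw [round, dif_neg hN]
      push_cast
      linarith

end Problem

/-! ### Sample sizes at the worst noise rate, and elementary logarithm estimates -/

lemma ermSize_le {c : ℝ} (hc : 0 ≤ c) (d : ℕ) {ε δ η m : ℝ} (hε : 0 < ε) (hδ : 0 < δ)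
    (hδ1 : δ ≤ 1) (hm : 0 < m) (hη : m ≤ 1 - 2 * η) :
    (ermSize c d ε δ η : ℝ) ≤ c * (d * Real.log (1 / δ) / (ε * m ^ 2)) + 1 := by
  have hl : 0 ≤ Real.log (1 / δ) := Real.log_nonneg (by rwa [le_div_iff₀ hδ, one_mul])
  refine (Nat.ceil_lt_add_one ?_).le.trans ?_
  · positivity
  · gcongr

lemma testSize_le {c : ℝ} (hc : 0 ≤ c) {n k : ℕ} (hn : 0 < n) (hnk : n ≤ k) {ε δ η m : ℝ}
    (hε : 0 < ε) (hδ : 0 < δ) (hδ1 : δ ≤ 1) (hm : 0 < m) (hη : m ≤ 1 - 2 * η) :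
    (testSize c n ε δ η : ℝ) ≤ c * (Real.log (k / δ) / (ε * m)) + 1 := by
  have hn1 : (1 : ℝ) ≤ n := by exact_mod_cast hn
  have hnk' : (n : ℝ) ≤ k := by exact_mod_cast hnk
  have hl : 0 ≤ Real.log (n / δ) := Real.log_nonneg (by rw [le_div_iff₀ hδ]; linarith)
  have hl' : Real.log (n / δ) ≤ Real.log (k / δ) := Real.log_le_log (by positivity) (by gcongr)
  have hη0 : 0 < 1 - 2 * η := hm.trans_le hη
  refine (Nat.ceil_lt_add_one (by positivity)).le.trans ?_
  gcongr
  exact hl.trans hl'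

/-- From `2^3 ≤ 3^2 ≤ k^2`. This keeps `ln (log k)` away from zero; at `k = 2` it would vanish. -/
lemma three_halves_le_logb {k : ℕ} (hk : 3 ≤ k) : 3 / 2 ≤ Real.logb 2 k := by
  have hk' : (3 : ℝ) ≤ k := by exact_mod_cast hk
  have h : Real.logb 2 ((2 : ℝ) ^ 3) ≤ Real.logb 2 ((k : ℝ) ^ 2) :=
    Real.logb_le_logb_of_le (by norm_num) (by norm_num) (by nlinarith)
  rw [Real.logb_pow, Real.logb_pow, Real.logb_self_eq_one (by norm_num)] at h
  push_cast at h
  linarith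

lemma one_third_le_log {x : ℝ} (hx : 3 / 2 ≤ x) : 1 / 3 ≤ Real.log x := by
  have h := Real.one_sub_inv_le_log_of_pos (show (0 : ℝ) < 3 / 2 by norm_num)
  have h' := Real.log_le_log (by norm_num) hx
  norm_num at h h'
  linarith

lemma one_le_log {x : ℝ} (hx : 3 ≤ x) : 1 ≤ Real.log x := by
  rw [Real.le_log_iff_exp_le (by linarith)]
  linarith [Real.exp_one_lt_d9]

lemma logb_two_le_self {k : ℕ} (hk : 0 < k) : Real.logb 2 k ≤ k := by
  rw [Real.logb_le_iff_le_rpow (by norm_num) (by exact_mod_cast hk), Real.rpow_natCast]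
  exact_mod_cast Nat.lt_two_pow_self.le

namespace Problem

variable {X : Type u} [MeasurableSpace X] {k : ℕ}

/-- The sample complexity bound, valid for every outcome of the draws. -/
lemma samplesUsed_le (P : Problem X k) {c₁ c₂ δ : ℝ} (hc₁ : 0 < c₁) (hc₂ : 0 < c₂) (hδ : 0 < δ)
    (hδ1 : δ < 1) (d : ℕ) {ε : ℝ} (hε : 0 < ε) (hε1 : ε < 1) (hk : 3 ≤ k)
    (erm : List (X × Bool) → X → Bool) (ω : Address k → X × Bool) :
    (P.samplesUsed c₁ c₂ d ε δ erm ω : ℝ) ≤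
      2 * ((4 * c₁ + c₂) * (3 * Real.log (2 / δ) + 1) + 2) * (Real.logb 2 k *
        (k * Real.log (k * Real.logb 2 k) / (ε * (1 - 2 * P.maxNoise)) +
          d * Real.log (Real.logb 2 k) / (ε * (1 - 2 * P.maxNoise) ^ 2))) := by
  have hk' : (3 : ℝ) ≤ k := by exact_mod_cast hk
  have hL := three_halves_le_logb hk
  set L := Real.logb 2 k
  have hm : 0 < 1 - 2 * P.maxNoise := by linarith [P.maxNoise_lt_half (by omega)]
  have hm1 : 1 - 2 * P.maxNoise ≤ 1 := by linarith [P.maxNoise_nonneg]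
  have hηm (i : Fin k) : 1 - 2 * P.maxNoise ≤ 1 - 2 * P.η i := by linarith [P.η_le_maxNoise i]
  have havg {N : Finset (Fin k)} (hN : N.Nonempty) :
      1 - 2 * P.maxNoise ≤ 1 - 2 * P.avgNoise N := by linarith [P.avgNoise_le_maxNoise hN]
  set m := 1 - 2 * P.maxNoise
  have hδ' : 0 < δ / (2 * L) := by positivity
  have hδ'1 : δ / (2 * L) ≤ 1 := by rw [div_le_one (by positivity)]; linarith
  have hD : 0 ≤ Real.log (2 / δ) := Real.log_nonneg (by rw [le_div_iff₀ hδ]; linarith)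
  set D := Real.log (2 / δ)
  have hlogL := one_third_le_log hL
  have hlogkL : 1 ≤ Real.log (k * L) := one_le_log (by nlinarith)
  -- The left side is `D + ln L`, and `D ≤ 3 D ln L` because `ln L ≥ 1/3`.
  have e₁ : Real.log (1 / (δ / (2 * L))) ≤ (3 * D + 1) * Real.log L := by
    rw [show 1 / (δ / (2 * L)) = 2 / δ * L by field_simp,
      Real.log_mul (by positivity) (by positivity)]
    nlinarith
  have e₂ : Real.log (k / (δ / (2 * L))) ≤ (3 * D + 1) * Real.log (k * L) := by
    rw [show k / (δ / (2 * L)) = 2 / δ * (k * L) by field_simp,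
      Real.log_mul (by positivity) (by positivity)]
    nlinarith
  have hone : 1 ≤ Real.log (k * L) / (ε * m) := by
    rw [le_div_iff₀ (by positivity)]
    nlinarith
  set U := k * Real.log (k * L) / (ε * m) with hU
  set V := d * Real.log L / (ε * m ^ 2) with hV
  -- Rounding up costs at most `k + 1 ≤ 2k ≤ 2U` per round. It is charged to `U` because `V`
  -- vanishes for `d = 0`.
  have hkU : (k : ℝ) ≤ U := by
    rw [hU, mul_div_assoc]
    exact le_mul_of_one_le_right (by positivity) hone
  have hV0 : 0 ≤ V := by positivity
  have hround (N : Finset (Fin k)) (hN : N.Nonempty) :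
      (ermSize c₁ d (ε / 4) (δ / (2 * L)) (P.avgNoise N) : ℝ) +
        ∑ i ∈ N, (testSize c₂ N.card ε (δ / (2 * L)) (P.η i) : ℝ) ≤
      ((4 * c₁ + c₂) * (3 * D + 1) + 2) * (U + V) := by
    have hNk : N.card ≤ k := by simpa using N.card_le_univ
    have h₁ : (ermSize c₁ d (ε / 4) (δ / (2 * L)) (P.avgNoise N) : ℝ) ≤
        4 * c₁ * (3 * D + 1) * V + 1 := by
      refine (ermSize_le hc₁.le d (by positivity) hδ' hδ'1 hm (havg hN)).trans ?_
      calc _ ≤ c₁ * (d * ((3 * D + 1) * Real.log L) / (ε / 4 * m ^ 2)) + 1 := by gcongr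
        -- The factor `4` comes from the accuracy `ε/4`.
        _ = _ := by rw [hV]; field_simp
    have h₂ : ∑ i ∈ N, (testSize c₂ N.card ε (δ / (2 * L)) (P.η i) : ℝ) ≤
        c₂ * (3 * D + 1) * U + k := by
      have hterm (i : Fin k) : (testSize c₂ N.card ε (δ / (2 * L)) (P.η i) : ℝ) ≤
          c₂ * ((3 * D + 1) * Real.log (k * L) / (ε * m)) + 1 := by
        refine (testSize_le hc₂.le hN.card_pos hNk hε hδ' hδ'1 hm (hηm i)).trans ?_
        gcongr
      refine (Finset.sum_le_card_nsmul _ _ _ fun i _ => hterm i).trans ?_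
      rw [nsmul_eq_mul]
      calc _ ≤ (k : ℝ) * (c₂ * ((3 * D + 1) * Real.log (k * L) / (ε * m)) + 1) := by
            gcongr
        _ = _ := by rw [hU]; field_simp
    -- Nonnegative cross terms, added to obtain a common factor of `U + V`.
    have h₃ : 0 ≤ c₁ * (3 * D + 1) * U := by positivity
    have h₄ : 0 ≤ c₂ * (3 * D + 1) * V := by positivity
    linarith
  have hB0 : 0 ≤ ((4 * c₁ + c₂) * (3 * D + 1) + 2) * (U + V) := by positivity
  refine (P.length_drawn_stateAfter_le c₁ c₂ d ε _ erm ω hB0 hround _).trans ?_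
  have hceil : (⌈L⌉₊ : ℝ) ≤ 2 * L := by
    linarith [(Nat.ceil_lt_add_one (show 0 ≤ L by positivity)).le]
  calc _ ≤ 2 * L * (((4 * c₁ + c₂) * (3 * D + 1) + 2) * (U + V)) := by gcongr
    _ = _ := by ring

end Problem

/-- If `k ln k ≤ A d`, the term of the test samples is absorbed, up to a logarithmic factor. -/
lemma complexity_le_of_mul_log_le {A ε m : ℝ} {k d : ℕ} (hk : 3 ≤ k) (hε : 0 < ε) (hε1 : ε < 1)
    (hm : 0 < m) (hm1 : m ≤ 1) (hA : k * Real.log k ≤ A * d) :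
    Real.logb 2 k * (k * Real.log (k * Real.logb 2 k) / (ε * m) +
        d * Real.log (Real.logb 2 k) / (ε * m ^ 2)) ≤
      (6 * |A| + 1) * (Real.logb 2 k * (d / (ε * m ^ 2))) *
        Real.log (Real.logb 2 k * (d / (ε * m ^ 2))) := by
  have hk' : (3 : ℝ) ≤ k := by exact_mod_cast hk
  have hL := three_halves_le_logb hk
  have hLk := logb_two_le_self (show 0 < k by omega)
  set L := Real.logb 2 k
  have hlogk := one_le_log hk'
  -- For `d = 0` the assumption would give `k ln k ≤ 0`. Having `d ≥ 1` yields `F ≥ L`, hence `ln F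
  -- ≥ ln L ≥ 1/3`.
  have hd : (1 : ℝ) ≤ d := by
    rcases Nat.eq_zero_or_pos d with rfl | h
    · norm_num at hA
      nlinarith
    · exact_mod_cast h
  have hem : ε * m ^ 2 ≤ 1 := mul_le_one₀ hε1.le (by positivity) (pow_le_one₀ hm.le hm1)
  have hemm : ε * m ^ 2 ≤ ε * m := by
    gcongr
    nlinarith
  have hF : L ≤ L * (d / (ε * m ^ 2)) := by
    refine le_mul_of_one_le_right (by positivity) ?_
    rw [le_div_iff₀ (by positivity)]
    linarith
  have hlogF : Real.log L ≤ Real.log (L * (d / (ε * m ^ 2))) :=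
    Real.log_le_log (by positivity) hF
  have hlogF' := (one_third_le_log hL).trans hlogF
  set ℓ := Real.log (L * (d / (ε * m ^ 2)))
  have hkL : Real.log (k * L) ≤ 2 * Real.log k := by
    rw [Real.log_mul (by positivity) (by positivity)]
    linarith [Real.log_le_log (by positivity) hLk]
  -- The `6` is `2` from `ln (kL) ≤ 2 ln k` times `3` from `1 ≤ 3ℓ`. Using `|A|` keeps the final
  -- constant positive for every `A`.
  have hfirst : k * Real.log (k * L) ≤ 6 * |A| * ℓ * d := by
    have h₁ : A * d ≤ |A| * d := by gcongr; exact le_abs_self A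
    have h₂ : |A| * d ≤ 3 * ℓ * (|A| * d) :=
      le_mul_of_one_le_left (by positivity) (by linarith)
    nlinarith
  calc _ ≤ L * (6 * |A| * ℓ * d / (ε * m ^ 2) + d * ℓ / (ε * m ^ 2)) := by
        gcongr
    _ = _ := by ring

end CollabCN

theorem proposition16 (c₁ c₂ δ : ℝ) (hc₁ : 0 < c₁) (hc₂ : 0 < c₂) (hδ : 0 < δ) (hδ1 : δ < 1) :
    (∃ C : ℝ, 0 < C ∧
      ∀ (X : Type u) [MeasurableSpace X] (k d : ℕ) (P : CollabCN.Problem X k) (ε : ℝ)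
        (erm : List (X × Bool) → X → Bool),
        3 ≤ k → CollabCN.HasVCDim P.H d → 0 < ε → ε < 1 → CollabCN.IsERM P.H erm →
        ∀ᵐ ω ∂P.law, (P.samplesUsed c₁ c₂ d ε δ erm ω : ℝ) ≤
          C * (Real.logb 2 k *
            (k * Real.log (k * Real.logb 2 k) / (ε * (1 - 2 * P.maxNoise)) +
              d * Real.log (Real.logb 2 k) / (ε * (1 - 2 * P.maxNoise) ^ 2)))) ∧
    (∀ A : ℝ, ∃ (C : ℝ) (p : ℕ), 0 < C ∧
      ∀ (X : Type u) [MeasurableSpace X] (k d : ℕ) (P : CollabCN.Problem X k) (ε : ℝ)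
        (erm : List (X × Bool) → X → Bool),
        3 ≤ k → CollabCN.HasVCDim P.H d → 0 < ε → ε < 1 → CollabCN.IsERM P.H erm →
        k * Real.log k ≤ A * d →
        ∀ᵐ ω ∂P.law, (P.samplesUsed c₁ c₂ d ε δ erm ω : ℝ) ≤
          C * (Real.logb 2 k * (d / (ε * (1 - 2 * P.maxNoise) ^ 2))) *
            Real.log (Real.logb 2 k * (d / (ε * (1 - 2 * P.maxNoise) ^ 2))) ^ p) := by
  have hD : 0 ≤ Real.log (2 / δ) := Real.log_nonneg (by rw [le_div_iff₀ hδ]; linarith)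
  refine ⟨⟨2 * ((4 * c₁ + c₂) * (3 * Real.log (2 / δ) + 1) + 2), by positivity, ?_⟩,
    fun A => ⟨2 * ((4 * c₁ + c₂) * (3 * Real.log (2 / δ) + 1) + 2) * (6 * |A| + 1), 1,
      by positivity, ?_⟩⟩
  · intro X _ k d P ε erm hk _ hε hε1 _
    exact Filter.Eventually.of_forall fun ω =>
      P.samplesUsed_le hc₁ hc₂ hδ hδ1 d hε hε1 hk erm ω
  · intro X _ k d P ε erm hk _ hε hε1 _ hA
    refine Filter.Eventually.of_forall fun ω =>
      (P.samplesUsed_le hc₁ hc₂ hδ hδ1 d hε hε1 hk erm ω).trans ?_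
    have hm : 0 < 1 - 2 * P.maxNoise := by linarith [P.maxNoise_lt_half (by omega)]
    have hm1 : 1 - 2 * P.maxNoise ≤ 1 := by linarith [P.maxNoise_nonneg]
    have h := CollabCN.complexity_le_of_mul_log_le hk hε hε1 hm hm1 hA
    rw [pow_one]
    refine (mul_le_mul_of_nonneg_left h (by positivity)).trans_eq ?_
    ring
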